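/- For every $\varepsilon\in(0,1)$ there are a bounded domain $D\subset\mathbb C^2$ that has $C^{1,1-\varepsilon}$-smooth boundary (near each boundary point $D=\{r<0\}$ for a $C^1$ function $r$ with nowhere vanishing derivative that is Hölder continuous of order $1-\varepsilon$) and is not pseudoconvex (there is no continuous plurisubharmonic function on $D$ all of whose sublevel sets are relatively compact in $D$), and a plurisubharmonic function $u:D\to[-\infty,0)$ with $\limsup_{D\ni z\to a}u(z)=0$ for every $a\in\partial D$. In particular, $v:=-\log(-u)$ (with $v=-\infty$ where $u=-\infty$) is plurisubharmonic on $D$ and $\limsup_{D\ni z\to a}v(z)=\infty$ for every $a\in\partial D$. -/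

import Mathlib

open Set Filter Topology MeasureTheory
open scoped NNReal ENNReal

/-- The mean value over the circle `|ζ - c| = r` of an extended-real-valued function, as the mean of
the positive part minus the mean of the negative part. For a function that is upper semicontinuous
and nowhere `+∞` on the circle the first mean is finite, so the difference is meaningful and lies in
`[-∞, ∞)`. -/
noncomputable def circleMean (f : ℂ → EReal) (c : ℂ) (r : ℝ) : EReal :=
  ((⨍⁻ θ in Ioc (0 : ℝ) (2 * Real.pi), (f (circleMap c r θ)).toENNReal ∂volume : ℝ≥0∞) : EReal) -
    ((⨍⁻ θ in Ioc (0 : ℝ) (2 * Real.pi), (-f (circleMap c r θ)).toENNReal ∂volume : ℝ≥0∞) : EReal)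

/-- Subharmonic functions `U → [-∞, ∞)` on an open set `U ⊆ ℂ`: upper semicontinuous functions with
the (local) sub-mean value property. -/
structure IsSubharmonicOn (f : ℂ → EReal) (U : Set ℂ) : Prop where
  ne_top : ∀ z ∈ U, f z ≠ ⊤
  usc : UpperSemicontinuousOn f U
  submean : ∀ z ∈ U, ∃ ρ : ℝ, 0 < ρ ∧ ∀ r : ℝ, 0 < r → r < ρ → f z ≤ circleMean f z r

/-- Plurisubharmonic functions `D → [-∞, ∞)` on an open set `D`: upper semicontinuous functions
whose restriction to every complex line is subharmonic. -/
structure IsPlurisubharmonicOn {E : Type*} [NormedAddCommGroup E] [NormedSpace ℂ E]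
    (u : E → EReal) (D : Set E) : Prop where
  usc : UpperSemicontinuousOn u D
  line : ∀ a w : E, IsSubharmonicOn (fun ζ : ℂ => u (a + ζ • w)) {ζ : ℂ | a + ζ • w ∈ D}

/-- An open set `D` is pseudoconvex if it carries a continuous plurisubharmonic exhaustion function,
i.e. one all of whose sublevel sets are relatively compact in `D`. -/
def IsPseudoconvex {E : Type*} [NormedAddCommGroup E] [NormedSpace ℂ E] (D : Set E) : Prop :=
  IsOpen D ∧ ∃ ρ : E → EReal, IsPlurisubharmonicOn ρ D ∧ ContinuousOn ρ D ∧
    ∀ c : ℝ, ∃ K : Set E, IsCompact K ∧ K ⊆ D ∧ {z ∈ D | ρ z < (c : EReal)} ⊆ K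

/-- The open set `D` has `C^{1,α}`-smooth boundary: near each boundary point it is
`{r < 0}` for a function `r` with nowhere vanishing derivative which is `C^1` with `α`-Hölder
continuous derivative. -/
def HasC1HolderBoundary {E : Type*} [NormedAddCommGroup E] [NormedSpace ℝ E]
    (D : Set E) (α : ℝ≥0) : Prop :=
  ∀ a ∈ frontier D, ∃ (U : Set E) (r : E → ℝ), IsOpen U ∧ a ∈ U ∧
    ContDiffOn ℝ 1 r U ∧ (∃ C : ℝ≥0, HolderOnWith C α (fderiv ℝ r) U) ∧
    (∀ z ∈ U, fderiv ℝ r z ≠ 0) ∧ D ∩ U = {z ∈ U | r z < 0}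

/-- The function `-log(-u)` for `u` with values in `[-∞, 0)`; it is `-∞` where `u = -∞`. -/
noncomputable def negLogNeg {E : Type*} (u : E → EReal) (z : E) : EReal :=
  -ENNReal.log (-u z).toENNReal

/-! The domain is the Hartogs domain |w|² < g(z), with g(x + iy) = A(x) + A(y). The bump A is
C^{1,1} with A'' = ±1 almost everywhere: A'' = -1 near every rational, yet A'' = 1 on most of [-1,
1] (`exists_isDenselyConcaveBump`). The boundary is then C^{1,1}, hence C^{1,α} for all α ≤ 1.

Convexity in mean gives g an interior minimum over a square, so horizontal discs sweep out to a
boundary point while their rims stay in a compact part of the domain. The maximum principle rules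
out an exhaustion (`not_isPseudoconvex_hartogsDomain`).

Concavity at a rational point a gives g = T - |z - a|²/2 nearby, T real affine. So |w|² - T is
plurisubharmonic, negative in the domain, and tends to 0 towards the boundary over a. Scaled and cut
off at -1, it extends by -1. Scales tending to 0 make the family over all rational points locally
finite (`exists_isBarrierFamily`); its supremum is u. Every boundary point is a limit of points over
rational z close to the boundary in their fibre, whence limsup u = 0
(`frequently_nhdsWithin_of_dense_base`).

Plurisubharmonicity is always obtained from local supports by real parts of complex affine
functions, a property that survives suprema that are attained and u ↦ -log(-u). -/

/-! ### Circle means, affine supports and the maximum principle -/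

theorem circleMean_mono {f g : ℂ → EReal} {c : ℂ} {r : ℝ} (hr : 0 ≤ r)
    (h : ∀ ζ, ‖ζ - c‖ = r → f ζ ≤ g ζ) : circleMean f c r ≤ circleMean g c r := by
  have h' : ∀ θ : ℝ, f (circleMap c r θ) ≤ g (circleMap c r θ) := fun θ => h _ (by
    simp [circleMap, abs_of_nonneg hr])
  unfold circleMean
  refine EReal.sub_le_sub ?_ ?_
  · refine EReal.coe_ennreal_le_coe_ennreal_iff.2 (lintegral_mono fun θ => ?_)
    exact EReal.toENNReal_le_toENNReal (h' θ)
  · refine EReal.coe_ennreal_le_coe_ennreal_iff.2 (lintegral_mono fun θ => ?_)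
    exact EReal.toENNReal_le_toENNReal (EReal.neg_le_neg_iff.2 (h' θ))

theorem circleMean_coe_of_continuous {f : ℂ → ℝ} (hf : Continuous f) (c : ℂ) (r : ℝ) :
    circleMean (fun ζ => (f ζ : EReal)) c r = (Real.circleAverage f c r : ℝ) := by
  have hpi : (0 : ℝ) < 2 * Real.pi := by positivity
  set φ : ℝ → ℝ := fun θ => f (circleMap c r θ) with hφ
  have hφc : Continuous φ := hf.comp (continuous_circleMap c r)
  have hint : Integrable φ (volume.restrict (Ioc (0 : ℝ) (2 * Real.pi))) :=
    (hφc.continuousOn.integrableOn_Icc).mono_set Ioc_subset_Icc_self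
  have hP : ∫⁻ θ in Ioc (0 : ℝ) (2 * Real.pi), ENNReal.ofReal (φ θ) ≠ ⊤ :=
    hint.lintegral_lt_top.ne
  have hN : ∫⁻ θ in Ioc (0 : ℝ) (2 * Real.pi), ENNReal.ofReal (-φ θ) ≠ ⊤ :=
    hint.neg.lintegral_lt_top.ne
  have key := integral_eq_lintegral_pos_part_sub_lintegral_neg_part hint
  have hvol : (volume.restrict (Ioc (0 : ℝ) (2 * Real.pi))) univ = ENNReal.ofReal (2 * Real.pi) := by
    simp
  have hre : ∀ x : ℝ≥0∞, x ≠ ⊤ → ((((ENNReal.ofReal (2 * Real.pi))⁻¹ * x : ℝ≥0∞)) : EReal)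
      = (((2 * Real.pi)⁻¹ * x.toReal : ℝ) : EReal) := by
    intro x hx
    have hfin : (ENNReal.ofReal (2 * Real.pi))⁻¹ * x ≠ ⊤ :=
      ENNReal.mul_ne_top (ENNReal.inv_ne_top.2 (ENNReal.ofReal_pos.2 hpi).ne') hx
    have h := EReal.coe_toReal (mt EReal.coe_ennreal_eq_top_iff.1 hfin) (EReal.coe_ennreal_ne_bot _)
    rw [← h, EReal.toReal_coe_ennreal, ENNReal.toReal_mul, ENNReal.toReal_inv,
      ENNReal.toReal_ofReal hpi.le]
  unfold circleMean
  have e1 : ∀ θ : ℝ, ((f (circleMap c r θ) : ℝ) : EReal).toENNReal = ENNReal.ofReal (φ θ) := by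
    intro θ; simp [hφ]
  have e2 : ∀ θ : ℝ, (-((f (circleMap c r θ) : ℝ) : EReal)).toENNReal = ENNReal.ofReal (-φ θ) := by
    intro θ; rw [← EReal.coe_neg, EReal.toENNReal_of_ne_top (EReal.coe_ne_top _)]; simp [hφ]
  simp only [e1, e2, laverage_eq, hvol]
  rw [ENNReal.div_eq_inv_mul, ENNReal.div_eq_inv_mul, hre _ hP, hre _ hN, ← EReal.coe_sub,
    ← mul_sub, ← key, Real.circleAverage_def, intervalIntegral.integral_of_le hpi.le]
  rfl

theorem circleAverage_affine (c : ℝ) (κ z : ℂ) (r : ℝ) :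
    Real.circleAverage (fun ζ => c + (κ * (ζ - z)).re) z r = c := by
  have h : ∀ θ : ℝ, c + (κ * (circleMap z r θ - z)).re
      = c + (κ.re * r) * Real.cos θ - (κ.im * r) * Real.sin θ := by
    intro θ
    simp [circleMap, Complex.exp_ofReal_mul_I_re, Complex.exp_ofReal_mul_I_im]
    ring
  rw [Real.circleAverage_def]
  simp only [h]
  rw [intervalIntegral.integral_sub, intervalIntegral.integral_add]
  · have : Real.pi ≠ 0 := Real.pi_ne_zero
    simp
    field_simp
  all_goals apply Continuous.intervalIntegrable; fun_prop

theorem circleMean_affine (c : ℝ) (κ z : ℂ) (r : ℝ) :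
    circleMean (fun ζ => ((c + (κ * (ζ - z)).re : ℝ) : EReal)) z r = c := by
  rw [circleMean_coe_of_continuous (by fun_prop), circleAverage_affine]

/-- A continuous function that is locally bounded below, near each point, by the real part of a
complex affine function touching it at that point, is plurisubharmonic. -/
theorem isPlurisubharmonicOn_of_support {E : Type*} [NormedAddCommGroup E] [NormedSpace ℂ E]
    {D : Set E} (hD : IsOpen D) {u : E → EReal} {U : E → ℝ} (hu : ∀ p ∈ D, u p = U p)
    (hU : ContinuousOn U D)
    (hs : ∀ p ∈ D, ∃ l : E →L[ℂ] ℂ, ∀ᶠ q in 𝓝 p, U p + (l (q - p)).re ≤ U q) :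
    IsPlurisubharmonicOn u D := by
  have hc : ContinuousOn u D :=
    (continuous_coe_real_ereal.comp_continuousOn hU).congr hu
  refine ⟨hc.upperSemicontinuousOn, fun a w => ?_⟩
  have hline : Continuous fun ζ : ℂ => a + ζ • w := by fun_prop
  refine ⟨fun ζ hζ => by simp only [hu _ hζ]; exact EReal.coe_ne_top _, ?_, fun ζ hζ => ?_⟩
  · exact (hc.comp hline.continuousOn (fun ζ hζ => hζ)).upperSemicontinuousOn
  · obtain ⟨l, hl⟩ := hs _ hζ
    have ev : ∀ᶠ ξ in 𝓝 ζ, a + ξ • w ∈ D ∧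
        U (a + ζ • w) + (l ((a + ξ • w) - (a + ζ • w))).re ≤ U (a + ξ • w) :=
      (hline.continuousAt (x := ζ)).eventually (Filter.Eventually.and (hD.mem_nhds hζ) hl)
    obtain ⟨ρ, hρ, hball⟩ := Metric.eventually_nhds_iff.1 ev
    refine ⟨ρ, hρ, fun r hr hrρ => ?_⟩
    have hx : u (a + ζ • w) = U (a + ζ • w) := hu _ hζ
    show u (a + ζ • w) ≤ _
    rw [hx, ← circleMean_affine (U (a + ζ • w)) (l w) ζ r]
    refine circleMean_mono hr.le fun ξ hξ => ?_
    obtain ⟨h1, h2⟩ := hball (y := ξ) (by rw [dist_eq_norm, hξ]; exact hrρ)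
    rw [hu _ h1]
    refine EReal.coe_le_coe_iff.2 (le_trans (le_of_eq ?_) h2)
    have : (a + ξ • w) - (a + ζ • w) = (ξ - ζ) • w := by rw [sub_smul]; abel
    rw [this, map_smul, smul_eq_mul, mul_comm]

/-- Maximum principle for continuous subharmonic functions. -/
theorem IsSubharmonicOn.le_of_forall_boundary_le {f : ℂ → EReal} {U Q O : Set ℂ}
    (hf : IsSubharmonicOn f U) (hfc : ContinuousOn f U) (hQ : IsCompact Q) (hQU : Q ⊆ U)
    (hO : IsOpen O) (hOQ : O ⊆ Q) {m : ℝ} (hm : ∀ z ∈ Q, z ∉ O → f z ≤ m) :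
    ∀ z ∈ Q, f z ≤ m := by
  intro z hz
  by_contra! hlt
  -- Truncating at m removes the value -∞, so the argument can run in ℝ.
  set g : ℂ → ℝ := fun ζ => (max (f ζ) m).toReal with hg
  have hgf : ∀ ζ ∈ Q, (g ζ : EReal) = max (f ζ) m := fun ζ hζ => by
    refine EReal.coe_toReal ?_ ?_
    · exact (max_lt (lt_top_iff_ne_top.2 (hf.ne_top ζ (hQU hζ))) (EReal.coe_lt_top m)).ne
    · exact (lt_of_lt_of_le (EReal.bot_lt_coe m) (le_max_right _ _)).ne'
  have hgc : ContinuousOn g Q := by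
    intro ζ hζ
    have h1 : ContinuousWithinAt (fun ζ => max (f ζ) (m : EReal)) Q ζ :=
      ((hfc.mono hQU) ζ hζ).max continuousWithinAt_const
    have h2 := EReal.tendsto_toReal (a := max (f ζ) (m : EReal))
      (by rw [← hgf ζ hζ]; exact EReal.coe_ne_top _) (by rw [← hgf ζ hζ]; exact EReal.coe_ne_bot _)
    exact h2.comp h1
  have hgm : ∀ ζ ∈ Q, m ≤ g ζ := fun ζ hζ => by
    rw [← EReal.coe_le_coe_iff, hgf ζ hζ]; exact le_max_right _ _
  have hgz : m < g z := by
    rw [← EReal.coe_lt_coe_iff, hgf z hz]; exact lt_max_of_lt_left hlt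
  obtain ⟨R, hR⟩ := hQ.isBounded.exists_norm_le
  obtain ⟨η, hη, hηR⟩ : ∃ η : ℝ, 0 < η ∧ η * R ^ 2 < g z - m := by
    refine ⟨(g z - m) / (2 * (R ^ 2 + 1)), by have := sub_pos.2 hgz; positivity, ?_⟩
    rw [div_mul_eq_mul_div, div_lt_iff₀ (by positivity)]
    nlinarith [sub_pos.2 hgz, sq_nonneg R]
  obtain ⟨ζ, hζ, hmax⟩ := hQ.exists_isMaxOn ⟨z, hz⟩
    (f := fun ζ => g ζ + η * ‖ζ‖ ^ 2) (hgc.add (by fun_prop))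
  have hmax' : ∀ ξ ∈ Q, g ξ + η * ‖ξ‖ ^ 2 ≤ g ζ + η * ‖ζ‖ ^ 2 := fun ξ hξ => hmax hξ
  have hζm : m < g ζ := by
    have h1 := hmax' z hz
    have h2 : ‖ζ‖ ^ 2 ≤ R ^ 2 := pow_le_pow_left₀ (norm_nonneg _) (hR ζ hζ) 2
    nlinarith [sq_nonneg ‖z‖, mul_nonneg hη.le (sq_nonneg ‖z‖)]
  have hfζ : f ζ = g ζ := by
    have := hgf ζ hζ
    rcases le_total (f ζ) (m : EReal) with h | h
    · rw [max_eq_right h] at this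
      exact absurd (EReal.coe_injective this) hζm.ne'
    · rw [this, max_eq_left h]
  have hζO : ζ ∈ O := by
    by_contra hn
    have := hm ζ hζ hn
    rw [hfζ, EReal.coe_le_coe_iff] at this
    linarith
  obtain ⟨ρ, hρ, hsub⟩ := hf.submean ζ (hQU hζ)
  obtain ⟨ρ', hρ', hball⟩ := Metric.isOpen_iff.1 hO ζ hζO
  set r := min ρ ρ' / 2 with hr
  have hr0 : 0 < r := by have := lt_min hρ hρ'; positivity
  have hrρ : r < min ρ ρ' := by have := lt_min hρ hρ'; rw [hr]; linarith
  have h1 := hsub r hr0 (hrρ.trans_le (min_le_left _ _))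
  -- Maximality of g + η|·|² at ζ and the expansion of |ξ|² about ζ bound f on the circle by an
  -- affine function whose mean is g ζ - η r², against the submean inequality.
  have h2 : circleMean f ζ r ≤ ((g ζ - η * r ^ 2 : ℝ) : EReal) := by
    rw [← circleMean_affine (g ζ - η * r ^ 2) (-(2 * η * starRingEnd ℂ ζ)) ζ r]
    refine circleMean_mono hr0.le fun ξ hξ => ?_
    have hξO : ξ ∈ O := hball (by
      rw [Metric.mem_ball, dist_eq_norm, hξ]; exact hrρ.trans_le (min_le_right _ _))
    have hξQ := hOQ hξO
    refine (le_max_left (f ξ) m).trans ?_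
    rw [← hgf ξ hξQ, EReal.coe_le_coe_iff]
    have h3 := hmax' ξ hξQ
    have h4 : ‖ξ‖ ^ 2 = ‖ζ‖ ^ 2 + 2 * (starRingEnd ℂ ζ * (ξ - ζ)).re + r ^ 2 := by
      rw [← hξ, ← Complex.normSq_eq_norm_sq, ← Complex.normSq_eq_norm_sq,
        ← Complex.normSq_eq_norm_sq]
      simp [Complex.normSq_apply]; ring
    have h5 : (-(2 * η * starRingEnd ℂ ζ) * (ξ - ζ)).re
        = - (2 * η) * (starRingEnd ℂ ζ * (ξ - ζ)).re := by
      simp; ring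
    rw [h5]
    rw [h4] at h3
    nlinarith
  rw [hfζ] at h1
  have h3 := EReal.coe_le_coe_iff.1 (h1.trans h2)
  nlinarith [mul_pos hη (pow_pos hr0 2)]

/-! ### The densely concave bump -/

/-- A `C^{1,1}` function on the line with derivative `A'`, tending to `-∞` at infinity, with a local
minimum in `(-1, 1)`, which is nevertheless uniformly concave near each rational point. -/
structure IsDenselyConcaveBump (A A' : ℝ → ℝ) : Prop where
  hasDerivAt : ∀ x, HasDerivAt A (A' x) x
  lipschitz : LipschitzWith 1 A'
  one_le : ∀ x, |x| ≤ 2 → 1 ≤ A x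
  antitoneOn : AntitoneOn A (Ici 2)
  monotoneOn : MonotoneOn A (Iic (-2))
  le_nine : ∀ x, A x ≤ 9
  le_of_two_le : ∀ x, 2 ≤ |x| → A x ≤ 9 - (|x| - 2) ^ 2 / 2
  deriv_ne_zero : ∀ x, 2 < |x| → A' x ≠ 0
  dip : ∀ x, |x| ≤ 1 → A 0 + x ^ 2 / 2 - |x| / 8 ≤ A x
  eq_near_rat : ∀ q : ℚ, ∀ᶠ x in 𝓝 (q : ℝ), A x = A q + A' q * (x - q) - (x - q) ^ 2 / 2

/-- Outer regularity at a countable, hence null, set. The bound 1/16 yields the slope error 2 · 1/16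
= 1/8 in `dip`. -/
theorem exists_isOpen_rat_subset_volume_lt :
    ∃ V : Set ℝ, IsOpen V ∧ (∀ q : ℚ, (q : ℝ) ∈ V) ∧ volume V < ENNReal.ofReal (1 / 16) := by
  obtain ⟨V, hV, hVo, hv⟩ := (range ((↑) : ℚ → ℝ)).exists_isOpen_lt_of_lt (μ := volume)
    (ENNReal.ofReal (1 / 16)) (by rw [(countable_range _).measure_zero]; simp)
  exact ⟨V, hVo, fun q => hV ⟨q, rfl⟩, hv⟩

theorem hasDerivAt_sub_sq_div_two (c x : ℝ) : HasDerivAt (fun x => (x - c) ^ 2 / 2) (x - c) x := by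
  have h := (((hasDerivAt_id' x).sub_const c).fun_pow 2).div_const 2
  refine h.congr_deriv ?_
  norm_num

/-- Integrate twice the function f equal to 1 on [-1, 1] \ V and -1 elsewhere, V being a small open
neighbourhood of the rationals. Since |f| ≤ 1, the derivative is 1-Lipschitz. -/
theorem exists_isDenselyConcaveBump : ∃ A A' : ℝ → ℝ, IsDenselyConcaveBump A A' := by
  obtain ⟨V, hVo, hVq, hVv⟩ := exists_isOpen_rat_subset_volume_lt
  classical
  set S : Set ℝ := Icc (-1) 1 \ V with hS
  have hSm : MeasurableSet S := measurableSet_Icc.diff hVo.measurableSet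
  set f : ℝ → ℝ := fun x => S.indicator (fun _ => (2 : ℝ)) x - 1 with hf
  have hfm : Measurable f := (measurable_const.indicator hSm).sub_const 1
  have hfS : ∀ x ∈ S, f x = 1 := fun x hx => by simp [hf, hx]; norm_num
  have hfn : ∀ x, x ∉ S → f x = -1 := fun x hx => by simp [hf, hx]
  have hfb : ∀ x, ‖f x‖ ≤ 1 := fun x => by
    by_cases hx : x ∈ S
    · simp [hfS x hx]
    · simp [hfn x hx]
  have hfi : ∀ a b : ℝ, IntervalIntegrable f volume a b := fun a b =>
    (intervalIntegrable_const (c := (1 : ℝ))).mono_fun hfm.aestronglyMeasurable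
      (ae_of_all _ fun x => by simpa using hfb x)
  set B : ℝ → ℝ := fun x => ∫ t in (0 : ℝ)..x, f t with hB
  have hBsub : ∀ x y, B y - B x = ∫ t in x..y, f t := fun x y =>
    intervalIntegral.integral_interval_sub_left (hfi _ _) (hfi _ _)
  have hBl : LipschitzWith 1 B := LipschitzWith.of_dist_le_mul fun x y => by
    rw [dist_comm, Real.dist_eq, hBsub, dist_comm, Real.dist_eq]
    simpa using intervalIntegral.norm_integral_le_of_norm_le_const (f := f) (a := x) (b := y)
      (C := 1) fun t _ => hfb t
  have hB0 : B 0 = 0 := by simp [hB]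
  have hBabs : ∀ x, |B x| ≤ |x| := fun x => by
    have := hBl.dist_le_mul x 0
    simpa [hB0, Real.dist_eq] using this
  -- As |B| ≤ 2 on [-2, 2], A varies there by at most 4 from its value at 0; starting at 5 keeps it
  -- in [1, 9].
  set A : ℝ → ℝ := fun x => 5 + ∫ t in (0 : ℝ)..x, B t with hA
  have hA0 : A 0 = 5 := by simp [hA]
  have hAd : ∀ x, HasDerivAt A (B x) x := fun x =>
    (hBl.continuous.integral_hasStrictDerivAt 0 x).hasDerivAt.const_add 5
  -- `f = -1` on an interval makes `B` affine there
  have hBneg : ∀ x y, x ≤ y → (∀ t ∈ Ioo x y, t ∉ S) → B y - B x = -(y - x) := by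
    intro x y hxy h
    rw [hBsub, intervalIntegral.integral_of_le hxy, integral_Ioc_eq_integral_Ioo,
      setIntegral_congr_fun measurableSet_Ioo (fun t ht => hfn t (h t ht))]
    simp [hxy]
  -- B 1 ≤ 1, and beyond 1 the slope of B is -1; so B is negative past 2.
  have hBr : ∀ x, 1 ≤ x → B x ≤ 2 - x := fun x hx => by
    have h1 := hBneg 1 x hx (fun t ht h => by have := h.1.2; linarith [ht.1])
    have h2 := (abs_le.1 (hBabs 1)).2
    norm_num at h2; linarith
  have hBlft : ∀ x, x ≤ -1 → -2 - x ≤ B x := fun x hx => by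
    have h1 := hBneg x (-1) hx (fun t ht h => by have := h.1.1; linarith [ht.2])
    have h2 := (abs_le.1 (hBabs (-1))).1
    norm_num at h2; linarith
  have hA5 : ∀ x, |x| ≤ 2 → |A x - 5| ≤ 4 := fun x hx => by
    have := (convex_Icc (-2 : ℝ) 2).norm_image_sub_le_of_norm_hasDerivWithin_le (f := A) (f' := B)
      (C := 2) (x := 0) (y := x) (fun t _ => (hAd t).hasDerivWithinAt)
      (fun t ht => (hBabs t).trans (abs_le.2 ht)) (by constructor <;> norm_num) (abs_le.1 hx)
    rw [hA0] at this
    simp only [Real.norm_eq_abs, sub_zero] at this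
    linarith
  have hanti : AntitoneOn (fun x => A x + (x - 2) ^ 2 / 2) (Ici 2) := by
    have hd : ∀ x, HasDerivAt (fun x => A x + (x - 2) ^ 2 / 2) (B x + (x - 2)) x := fun x =>
      (hAd x).add (hasDerivAt_sub_sq_div_two 2 x)
    refine antitoneOn_of_deriv_nonpos (convex_Ici 2)
      (fun x _ => (hd x).continuousAt.continuousWithinAt)
      (fun x _ => (hd x).differentiableAt.differentiableWithinAt) (fun x hx => ?_)
    rw [(hd x).deriv]
    rw [interior_Ici] at hx
    linarith [hBr x (by linarith [mem_Ioi.1 hx])]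
  have hmono : MonotoneOn (fun x => A x + (x + 2) ^ 2 / 2) (Iic (-2)) := by
    have hd : ∀ x, HasDerivAt (fun x => A x + (x + 2) ^ 2 / 2) (B x + (x + 2)) x := fun x => by
      simpa using (hAd x).fun_add (hasDerivAt_sub_sq_div_two (-2) x)
    refine monotoneOn_of_deriv_nonneg (convex_Iic (-2))
      (fun x _ => (hd x).continuousAt.continuousWithinAt)
      (fun x _ => (hd x).differentiableAt.differentiableWithinAt) (fun x hx => ?_)
    rw [(hd x).deriv]
    rw [interior_Iic] at hx
    linarith [hBlft x (by linarith [mem_Iio.1 hx])]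
  have hbig : ∀ x, 2 ≤ |x| → A x ≤ 9 - (|x| - 2) ^ 2 / 2 := fun x hx => by
    rcases le_total 0 x with h0 | h0
    · rw [abs_of_nonneg h0] at hx ⊢
      have h1 := hanti (mem_Ici.2 le_rfl) (mem_Ici.2 hx) hx
      have h2 := (abs_le.1 (hA5 2 (by norm_num))).2
      simp only [sub_self] at h1
      linarith
    · rw [abs_of_nonpos h0] at hx ⊢
      have h1 := hmono (mem_Iic.2 (by linarith)) (mem_Iic.2 le_rfl) (show x ≤ -2 by linarith)
      have h2 := (abs_le.1 (hA5 (-2) (by norm_num))).2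
      simp only at h1
      nlinarith
  refine ⟨A, B, hAd, hBl, fun x hx => by linarith [(abs_le.1 (hA5 x hx)).1], ?_, ?_, ?_, hbig,
    ?_, ?_, ?_⟩
  · intro x hx y hy hxy
    have h1 := hanti hx hy hxy
    rw [mem_Ici] at hx hy
    simp only at h1
    nlinarith
  · intro x hx y hy hxy
    have h1 := hmono hx hy hxy
    rw [mem_Iic] at hx hy
    simp only at h1
    nlinarith
  · intro x
    rcases le_total |x| 2 with h | h
    · linarith [(abs_le.1 (hA5 x h)).2]
    · linarith [hbig x h, sq_nonneg (|x| - 2)]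
  · intro x hx
    rcases lt_abs.1 hx with h | h
    · exact (show B x < 0 by linarith [hBr x (by linarith)]).ne
    · exact (show 0 < B x by linarith [hBlft x (by linarith)]).ne'
  · have hcmp : ∀ t ∈ Icc (-1 : ℝ) 1, |B t - t| ≤ 1 / 8 := by
      intro t ht
      have h1 : B t - t = ∫ s in (0 : ℝ)..t, (f s - 1) := by
        rw [intervalIntegral.integral_sub (hfi _ _) (by simp)]; simp [hB]
      rw [h1, ← Real.norm_eq_abs]
      -- On [-1, 1] the second derivative differs from that of t²/2 only on V, and there by 2.
      have h2 : ∀ s ∈ uIoc (0 : ℝ) t, ‖f s - 1‖ ≤ V.indicator (fun _ => (2 : ℝ)) s := by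
        intro s hs
        have hs' : s ∈ Icc (-1 : ℝ) 1 := by
          rcases le_total 0 t with h | h
          · rw [uIoc_of_le h] at hs; exact ⟨by linarith [hs.1], hs.2.trans ht.2⟩
          · rw [uIoc_of_ge h] at hs; exact ⟨by linarith [hs.1, ht.1], by linarith [hs.2]⟩
        by_cases hsV : s ∈ V
        · rw [hfn s (fun h => h.2 hsV)]; simp [hsV]; norm_num
        · rw [hfS s ⟨hs', hsV⟩]; simp [hsV]
      have hVfin : volume V ≠ ⊤ := (hVv.trans_le le_top).ne
      have hVi : Integrable (V.indicator (fun _ => (2 : ℝ))) volume :=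
        (integrable_indicator_iff hVo.measurableSet).2 (integrableOn_const hVfin)
      calc ‖∫ s in (0 : ℝ)..t, (f s - 1)‖ ≤ ∫ s in uIoc (0 : ℝ) t, ‖f s - 1‖ :=
            intervalIntegral.norm_integral_le_integral_norm_uIoc
        _ ≤ ∫ s in uIoc (0 : ℝ) t, V.indicator (fun _ => (2 : ℝ)) s := by
            refine setIntegral_mono_on ?_ hVi.integrableOn measurableSet_uIoc h2
            exact ((intervalIntegrable_iff.1 ((hfi 0 t).sub (by simp)))).norm
        _ ≤ ∫ s, V.indicator (fun _ => (2 : ℝ)) s :=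
            setIntegral_le_integral hVi (ae_of_all _ fun s => indicator_nonneg (by simp) s)
        _ = volume.real V * 2 := by
            rw [integral_indicator hVo.measurableSet]; simp
        _ ≤ 1 / 8 := by
            have : volume.real V ≤ 1 / 16 := by
              rw [Measure.real]
              exact ENNReal.toReal_le_of_le_ofReal (by norm_num) hVv.le
            linarith
    intro x hx
    have := (convex_Icc (-1 : ℝ) 1).norm_image_sub_le_of_norm_hasDerivWithin_le
      (f := fun t => A t - t ^ 2 / 2) (f' := fun t => B t - t)
      (C := 1 / 8) (x := 0) (y := x) (fun t _ => by
        refine ((hAd t).sub ?_).hasDerivWithinAt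
        simpa using hasDerivAt_sub_sq_div_two 0 t)
      hcmp (by constructor <;> norm_num) (abs_le.1 hx)
    simp only [Real.norm_eq_abs, sub_zero] at this
    have := (abs_le.1 this).1
    norm_num at this
    linarith
  · intro q
    obtain ⟨ρ, hρ, hball⟩ := Metric.isOpen_iff.1 hVo q (hVq q)
    filter_upwards [Metric.ball_mem_nhds (q : ℝ) hρ] with x hx
    have hBq : ∀ t ∈ Metric.ball (q : ℝ) ρ, B t = B q - (t - q) := by
      intro t ht
      rw [Real.ball_eq_Ioo] at ht hball
      rcases le_total (q : ℝ) t with h | h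
      · have := hBneg q t h (fun s hs hsS => hsS.2 (hball ⟨by linarith [hs.1], hs.2.trans ht.2⟩))
        linarith
      · have := hBneg t q h (fun s hs hsS => hsS.2 (hball ⟨ht.1.trans hs.1, by linarith [hs.2]⟩))
        linarith
    have := (convex_ball (q : ℝ) ρ).norm_image_sub_le_of_norm_hasDerivWithin_le
      (f := fun t => A t - (B q * (t - q) - (t - q) ^ 2 / 2)) (f' := fun t => B t - (B q - (t - q)))
      (C := 0) (x := (q : ℝ)) (y := x) (fun t _ => by
        refine ((hAd t).sub (HasDerivAt.sub ?_ ?_)).hasDerivWithinAt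
        · simpa using ((hasDerivAt_id' t).sub_const (q : ℝ)).const_mul (B q)
        · exact hasDerivAt_sub_sq_div_two q t)
      (fun t ht => by simp [hBq t ht]) (Metric.mem_ball_self hρ) hx
    rw [zero_mul, norm_le_zero_iff] at this
    simp only [sub_self] at this
    linarith

/-! ### Geometry of the Hartogs domain -/

/-- The function `‖w‖² - A (re z) - A (im z)` of `(z, w) ∈ ℂ²`. -/
noncomputable def hartogsDefining (A : ℝ → ℝ) (p : EuclideanSpace ℂ (Fin 2)) : ℝ :=
  ‖p 1‖ ^ 2 - A (p 0).re - A (p 0).im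

/-- The Hartogs domain `‖w‖² < A (re z) + A (im z)` in `ℂ²`. -/
def hartogsDomain (A : ℝ → ℝ) : Set (EuclideanSpace ℂ (Fin 2)) :=
  {p | hartogsDefining A p < 0}

/-- Each summand of the derivative of `hartogsDefining A` has this form, L being a real coordinate.
-/
theorem lipschitzWith_comp_smul {E : Type*} [NormedAddCommGroup E] [NormedSpace ℝ E] {φ : ℝ → ℝ}
    {K : ℝ≥0} (hφ : LipschitzWith K φ) (L : E →L[ℝ] ℝ) :
    LipschitzWith (K * ‖L‖₊ * ‖L‖₊) fun x => φ (L x) • L :=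
  LipschitzWith.of_dist_le_mul fun x y => by
    have h0 : φ (L x) • L - φ (L y) • L = (φ (L x) - φ (L y)) • L := (sub_smul _ _ _).symm
    rw [dist_eq_norm, h0, norm_smul, ← dist_eq_norm]
    have h1 := hφ.dist_le_mul (L x) (L y)
    have h2 : dist (L x) (L y) ≤ ‖L‖ * dist x y := L.lipschitz.dist_le_mul x y
    push_cast
    calc dist (φ (L x)) (φ (L y)) * ‖L‖ ≤ (K * (‖L‖ * dist x y)) * ‖L‖ := by
          gcongr
          exact h1.trans (by gcongr)
      _ = _ := by ring

theorem LipschitzWith.holderOnWith_of_dist_le_one {X Y : Type*} [PseudoMetricSpace X]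
    [PseudoMetricSpace Y] {f : X → Y} {C α : ℝ≥0} (hf : LipschitzWith C f) (hα : α ≤ 1)
    {s : Set X} (hs : ∀ x ∈ s, ∀ y ∈ s, dist x y ≤ 1) : HolderOnWith C α f s := by
  intro x hx y hy
  refine (hf x y).trans ?_
  gcongr
  have h1 : edist x y ≤ 1 := by
    rw [edist_dist]; exact ENNReal.ofReal_le_one.2 (hs x hx y hy)
  calc edist x y = edist x y ^ (1 : ℝ) := (ENNReal.rpow_one _).symm
    _ ≤ edist x y ^ (α : ℝ) := ENNReal.rpow_le_rpow_of_exponent_ge h1 (by exact_mod_cast hα)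

namespace IsDenselyConcaveBump

variable {A A' : ℝ → ℝ}

theorem continuous (h : IsDenselyConcaveBump A A') : Continuous A :=
  continuous_iff_continuousAt.2 fun x => (h.hasDerivAt x).continuousAt

theorem continuous_hartogsDefining (h : IsDenselyConcaveBump A A') :
    Continuous (hartogsDefining A) := by
  have := h.continuous
  unfold hartogsDefining
  fun_prop

theorem isOpen_hartogsDomain (h : IsDenselyConcaveBump A A') : IsOpen (hartogsDomain A) :=
  isOpen_lt h.continuous_hartogsDefining continuous_const

theorem hartogsDefining_eq_zero (h : IsDenselyConcaveBump A A')
    {a : EuclideanSpace ℂ (Fin 2)} (ha : a ∈ frontier (hartogsDomain A)) :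
    hartogsDefining A a = 0 :=
  frontier_lt_subset_eq h.continuous_hartogsDefining continuous_const ha

/-- The derivative of the defining function is globally Lipschitz. If it vanished at a boundary
point, then w = 0 and both real coordinates of z would lie in [-2, 2], where g ≥ 2, contradicting
|w|² = g. -/
theorem hasC1HolderBoundary (h : IsDenselyConcaveBump A A') {α : ℝ≥0} (hα : α ≤ 1) :
    HasC1HolderBoundary (hartogsDomain A) α := by
  set P : Fin 2 → (EuclideanSpace ℂ (Fin 2) →L[ℝ] ℂ) := fun j =>
    (EuclideanSpace.proj j : EuclideanSpace ℂ (Fin 2) →L[ℂ] ℂ).restrictScalars ℝ with hP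
  set X : Fin 2 → (EuclideanSpace ℂ (Fin 2) →L[ℝ] ℝ) := fun j => Complex.reCLM.comp (P j) with hX
  set Y : Fin 2 → (EuclideanSpace ℂ (Fin 2) →L[ℝ] ℝ) := fun j => Complex.imCLM.comp (P j) with hY
  have hXa : ∀ j p, X j p = (p j).re := fun j p => rfl
  have hYa : ∀ j p, Y j p = (p j).im := fun j p => rfl
  set F : EuclideanSpace ℂ (Fin 2) → (EuclideanSpace ℂ (Fin 2) →L[ℝ] ℝ) := fun p =>
    (2 * X 1 p) • X 1 + (2 * Y 1 p) • Y 1 - A' (X 0 p) • X 0 - A' (Y 0 p) • Y 0 with hF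
  have hd : ∀ p, HasFDerivAt (hartogsDefining A) (F p) p := by
    intro p
    have hsq : ∀ (L : EuclideanSpace ℂ (Fin 2) →L[ℝ] ℝ),
        HasFDerivAt (fun q => (L q) ^ 2) ((2 * L p) • L) p := fun L => by
      have h1 : HasDerivAt (fun t : ℝ => t ^ 2) (2 * L p) (L p) := by
        simpa using hasDerivAt_pow 2 (L p)
      exact h1.comp_hasFDerivAt p L.hasFDerivAt
    have hA : ∀ (L : EuclideanSpace ℂ (Fin 2) →L[ℝ] ℝ),
        HasFDerivAt (fun q => A (L q)) (A' (L p) • L) p := fun L =>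
      (h.hasDerivAt (L p)).comp_hasFDerivAt p L.hasFDerivAt
    refine ((((hsq (X 1)).add (hsq (Y 1))).sub (hA (X 0))).sub (hA (Y 0))).congr_of_eventuallyEq
      (Eventually.of_forall fun q => ?_)
    simp only [hartogsDefining, ← Complex.normSq_eq_norm_sq, Complex.normSq_apply, hXa, hYa,
      Pi.add_apply, Pi.sub_apply]
    ring
  have hfd : fderiv ℝ (hartogsDefining A) = F := funext fun p => (hd p).fderiv
  have h2 : LipschitzWith 2 fun t : ℝ => 2 * t := LipschitzWith.of_dist_le_mul fun x y => by
    simp [Real.dist_eq, ← mul_sub, abs_mul]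
  have hlip := ((((lipschitzWith_comp_smul h2 (X 1)).add (lipschitzWith_comp_smul h2 (Y 1))).sub
    (lipschitzWith_comp_smul h.lipschitz (X 0))).sub (lipschitzWith_comp_smul h.lipschitz (Y 0)))
  change LipschitzWith _ F at hlip
  intro a ha
  have ha0 := h.hartogsDefining_eq_zero ha
  have hFa : F a ≠ 0 := by
    intro hz
    have ev : ∀ v : EuclideanSpace ℂ (Fin 2), 2 * (a 1).re * (v 1).re + 2 * (a 1).im * (v 1).im
        - A' (a 0).re * (v 0).re - A' (a 0).im * (v 0).im = 0 := fun v => by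
      have := congrArg (fun G => G v) hz
      simpa [hF, hXa, hYa] using this
    have e1 := ev !₂[0, 1]
    have e2 := ev !₂[0, Complex.I]
    have e3 := ev !₂[1, 0]
    have e4 := ev !₂[Complex.I, 0]
    simp at e1 e2 e3 e4
    have hw : a 1 = 0 := Complex.ext e1 e2
    have hx : |(a 0).re| ≤ 2 := not_lt.1 fun hlt => h.deriv_ne_zero _ hlt e3
    have hy : |(a 0).im| ≤ 2 := not_lt.1 fun hlt => h.deriv_ne_zero _ hlt e4
    have hx1 := h.one_le _ hx
    have hy1 := h.one_le _ hy
    simp only [hartogsDefining, hw, norm_zero] at ha0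
    linarith
  obtain ⟨η, hη, hball⟩ := Metric.eventually_nhds_iff_ball.1
    (hlip.continuous.continuousAt.eventually_ne hFa)
  -- Radius at most 1/2 keeps distances at most 1, where Lipschitz implies α-Hölder.
  refine ⟨Metric.ball a (min η (1 / 2)), hartogsDefining A, Metric.isOpen_ball,
    Metric.mem_ball_self (by positivity), ?_, ?_, ?_, ?_⟩
  · refine ContDiff.contDiffOn (contDiff_one_iff_fderiv.2
      ⟨fun p => (hd p).differentiableAt, ?_⟩)
    rw [hfd]; exact hlip.continuous
  · rw [hfd]
    refine ⟨_, hlip.holderOnWith_of_dist_le_one hα fun x hx y hy => ?_⟩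
    have hx' := (Metric.mem_ball.1 hx).trans_le (min_le_right _ _)
    have hy' := (Metric.mem_ball'.1 hy).trans_le (min_le_right _ _)
    linarith [dist_triangle x a y]
  · intro z hz
    rw [hfd]
    exact hball z (Metric.ball_subset_ball (min_le_left _ _) hz)
  · ext z; exact and_comm

theorem isBounded_hartogsDomain (h : IsDenselyConcaveBump A A') :
    Bornology.IsBounded (hartogsDomain A) := by
  have hx : ∀ x, -9 < A x → |x| ≤ 8 := fun x hx => by
    by_contra! hlt
    have := h.le_of_two_le x (by linarith)
    nlinarith
  -- |x|, |y| ≤ 8 contribute 2 · 64, and |w|² < g ≤ 18.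
  refine (Metric.isBounded_closedBall (x := (0 : EuclideanSpace ℂ (Fin 2)))
    (r := √(128 + 18))).subset fun p hp => ?_
  have hp' : ‖p 1‖ ^ 2 - A (p 0).re - A (p 0).im < 0 := hp
  have h1 := h.le_nine (p 0).re
  have h2 := h.le_nine (p 0).im
  have h3 := hx (p 0).re (by nlinarith [sq_nonneg ‖p 1‖])
  have h4 := hx (p 0).im (by nlinarith [sq_nonneg ‖p 1‖])
  rw [mem_closedBall_zero_iff, EuclideanSpace.norm_eq]
  refine Real.sqrt_le_sqrt ?_
  rw [Fin.sum_univ_two, ← Complex.normSq_eq_norm_sq, Complex.normSq_apply]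
  nlinarith [abs_le.1 h3, abs_le.1 h4, sq_abs (p 0).re, sq_abs (p 0).im, abs_nonneg (p 0).re,
    abs_nonneg (p 0).im]

/-- Each real coordinate of z can be moved straight into [-2, 2] without lowering A, so the segments
used for connectedness stay in the domain. -/
theorem exists_le_of_convex_combination (h : IsDenselyConcaveBump A A') (x : ℝ) :
    ∃ c, |c| ≤ 2 ∧ ∀ a b : ℝ, 0 ≤ a → 0 ≤ b → a + b = 1 → A x ≤ A (a * x + b * c) := by
  rcases le_or_gt |x| 2 with hx | hx
  · refine ⟨x, hx, fun a b _ _ hab => ?_⟩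
    rw [← add_mul, hab, one_mul]
  rcases lt_abs.1 hx with hx | hx
  · refine ⟨2, by norm_num, fun a b ha hb hab => h.antitoneOn
      (mem_Ici.2 ?_) (mem_Ici.2 hx.le) ?_⟩ <;> nlinarith
  · refine ⟨-2, by norm_num, fun a b ha hb hab => h.monotoneOn
      (mem_Iic.2 ?_) (mem_Iic.2 ?_) ?_⟩ <;> nlinarith

theorem isConnected_hartogsDomain (h : IsDenselyConcaveBump A A') :
    IsConnected (hartogsDomain A) := by
  have h0 : (0 : EuclideanSpace ℂ (Fin 2)) ∈ hartogsDomain A := by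
    have := h.one_le 0 (by norm_num)
    show hartogsDefining A 0 < 0
    simp [hartogsDefining]
    linarith
  refine ⟨⟨0, h0⟩, isPreconnected_of_forall 0 fun p hp => ?_⟩
  obtain ⟨c, hc, hc'⟩ := h.exists_le_of_convex_combination (p 0).re
  obtain ⟨d, hd, hd'⟩ := h.exists_le_of_convex_combination (p 0).im
  have hp' : ‖p 1‖ ^ 2 - A (p 0).re - A (p 0).im < 0 := hp
  set q : EuclideanSpace ℂ (Fin 2) := !₂[(⟨c, d⟩ : ℂ), 0] with hq
  refine ⟨segment ℝ 0 q ∪ segment ℝ p q, union_subset ?_ ?_, Or.inl (left_mem_segment _ _ _),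
    Or.inr (left_mem_segment _ _ _), ?_⟩
  · rintro _ ⟨a, b, ha, hb, hab, rfl⟩
    have hb1 : b ≤ 1 := by linarith
    have hs : ∀ t : ℝ, |t| ≤ 2 → |b * t| ≤ 2 := fun t ht => by
      rw [abs_mul, abs_of_nonneg hb]; nlinarith [abs_nonneg t]
    have h1 := h.one_le _ (hs c hc)
    have h2 := h.one_le _ (hs d hd)
    show hartogsDefining A _ < 0
    simp [hartogsDefining, hq]
    linarith
  · rintro _ ⟨a, b, ha, hb, hab, rfl⟩
    have h1 := hc' a b ha hb hab
    have h2 := hd' a b ha hb hab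
    have h3 : (a * ‖p 1‖) ^ 2 ≤ ‖p 1‖ ^ 2 := by
      refine pow_le_pow_left₀ (by positivity) ?_ 2
      nlinarith [norm_nonneg (p 1)]
    show hartogsDefining A _ < 0
    simp [hartogsDefining, hq, abs_of_nonneg ha]
    linarith
  · exact IsPreconnected.union q (right_mem_segment _ _ _) (right_mem_segment _ _ _)
      (convex_segment _ _).isPreconnected (convex_segment _ _).isPreconnected

/-- Kontinuitätssatz with the discs Q × {s}, s ↑ W = √(min g over Q): their rims stay in a fixed
compact subset of the domain, but the points over the minimizer z₀ reach the boundary. -/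
theorem not_isPseudoconvex_hartogsDomain (h : IsDenselyConcaveBump A A') :
    ¬ IsPseudoconvex (hartogsDomain A) := by
  rintro ⟨-, ρ, hρ, hρc, hex⟩
  have hA := h.continuous
  set g : ℂ → ℝ := fun z => A z.re + A z.im with hg
  have hgc : Continuous g := by fun_prop
  set Q : Set ℂ := Icc (-1) 1 ×ℂ Icc (-1) 1 with hQ
  set O : Set ℂ := Ioo (-1) 1 ×ℂ Ioo (-1) 1 with hO
  have hQc : IsCompact Q := isCompact_Icc.reProdIm isCompact_Icc
  have hOo : IsOpen O := isOpen_Ioo.reProdIm isOpen_Ioo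
  have hOQ : O ⊆ Q := fun z hz => ⟨Ioo_subset_Icc_self hz.1, Ioo_subset_Icc_self hz.2⟩
  have h0Q : (0 : ℂ) ∈ Q := by simp [hQ, Complex.mem_reProdIm]
  obtain ⟨z₀, hz₀, hmin⟩ := hQc.exists_isMinOn ⟨0, h0Q⟩ hgc.continuousOn
  have hmin' : ∀ z ∈ Q, g z₀ ≤ g z := fun z hz => hmin hz
  have hpos : 0 < g z₀ := by
    have h1 := h.one_le z₀.re ((abs_le.2 hz₀.1).trans (by norm_num))
    have h2 := h.one_le z₀.im ((abs_le.2 hz₀.2).trans (by norm_num))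
    simp only [hg]; linarith
  have hbdry : ∀ z ∈ Q, z ∉ O → g z₀ < g z := by
    intro z hz hzO
    refine (hmin' 0 h0Q).trans_lt ?_
    have hx := abs_le.2 hz.1
    have hy := abs_le.2 hz.2
    have h1 := h.dip z.re hx
    have h2 := h.dip z.im hy
    have h3 : |z.re| = 1 ∨ |z.im| = 1 := by
      by_contra! hne
      exact hzO ⟨abs_lt.1 (lt_of_le_of_ne hx hne.1), abs_lt.1 (lt_of_le_of_ne hy hne.2)⟩
    simp only [hg, Complex.zero_re, Complex.zero_im]
    rw [← sq_abs] at h1 h2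
    -- On an edge one coordinate gains at least 1/2 - 1/8, while the other loses at most 1/128, the
    -- worst case of t²/2 - t/8.
    rcases h3 with h3 | h3 <;> simp only [h3] at h1 h2 <;>
      nlinarith [sq_nonneg (|z.re| - 1 / 8), sq_nonneg (|z.im| - 1 / 8)]
  set W : ℝ := √(g z₀) with hW
  have hWsq : W ^ 2 = g z₀ := Real.sq_sqrt hpos.le
  have hW0 : 0 < W := Real.sqrt_pos.2 hpos
  set γ : ℂ × ℝ → EuclideanSpace ℂ (Fin 2) := fun x => !₂[x.1, (x.2 : ℂ)] with hγ
  have hγc : Continuous γ := by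
    refine (PiLp.continuous_toLp 2 _).comp (continuous_pi fun i => ?_)
    fin_cases i
    · exact continuous_fst
    · exact Complex.continuous_ofReal.comp continuous_snd
  have hγD : ∀ z s, γ (z, s) ∈ hartogsDomain A ↔ s ^ 2 < g z := fun z s => by
    show hartogsDefining A _ < 0 ↔ _
    simp only [hartogsDefining, hγ, hg]
    simp
    constructor <;> intro <;> linarith
  -- a bound on the union of the boundaries of the discs
  have hKc : IsCompact (γ '' ((Q \ O) ×ˢ Icc 0 W)) :=
    ((hQc.diff hOo).prod isCompact_Icc).image hγc
  have hKD : γ '' ((Q \ O) ×ˢ Icc 0 W) ⊆ hartogsDomain A := by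
    rintro _ ⟨⟨z, s⟩, ⟨hz, hs⟩, rfl⟩
    rw [hγD]
    have := hbdry z hz.1 hz.2
    have : s ^ 2 ≤ W ^ 2 := pow_le_pow_left₀ hs.1 hs.2 2
    linarith
  have htop : ∀ p ∈ hartogsDomain A, ρ p ≠ ⊤ := fun p hp => by
    have := (hρ.line p 0).ne_top 0 (by simpa using hp)
    simpa using this
  obtain ⟨m, hm⟩ : ∃ m : ℝ, ∀ p ∈ γ '' ((Q \ O) ×ˢ Icc 0 W), ρ p ≤ m := by
    rcases (γ '' ((Q \ O) ×ˢ Icc 0 W)).eq_empty_or_nonempty with he | hne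
    · exact ⟨0, by simp [he]⟩
    obtain ⟨p, hp, hmax⟩ := hKc.exists_isMaxOn hne (hρc.mono hKD)
    obtain ⟨m, hm, -⟩ := EReal.lt_iff_exists_real_btwn.1 (lt_top_iff_ne_top.2 (htop p (hKD hp)))
    exact ⟨m, fun q hq => (hmax hq).trans hm.le⟩
  obtain ⟨K, hK, hKD', hKsub⟩ := hex (m + 1)
  have hin : ∀ s ∈ Ico 0 W, γ (z₀, s) ∈ K := by
    intro s hs
    have hsW : s ^ 2 < W ^ 2 := pow_lt_pow_left₀ hs.2 hs.1 two_ne_zero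
    have hline : ∀ ζ : ℂ, !₂[(0 : ℂ), (s : ℂ)] + ζ • !₂[(1 : ℂ), (0 : ℂ)] = γ (ζ, s) := fun ζ => by
      ext i; fin_cases i <;> simp [hγ]
    have hsub := hρ.line !₂[(0 : ℂ), (s : ℂ)] !₂[(1 : ℂ), (0 : ℂ)]
    simp only [hline] at hsub
    have hQD : ∀ z ∈ Q, γ (z, s) ∈ hartogsDomain A := fun z hz => by
      rw [hγD]; linarith [hmin' z hz]
    have hle := hsub.le_of_forall_boundary_le
      (hρc.comp (hγc.comp (by fun_prop : Continuous fun ζ : ℂ => (ζ, s))).continuousOn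
        fun ζ hζ => hζ) hQc hQD hOo hOQ
      (fun z hz hzO => hm _ ⟨(z, s), ⟨⟨hz, hzO⟩, hs.1, hs.2.le⟩, rfl⟩) z₀ hz₀
    refine hKsub ⟨hQD z₀ hz₀, hle.trans_lt ?_⟩
    exact EReal.coe_lt_coe_iff.2 (by linarith)
  have hlim : γ (z₀, W) ∈ K := by
    have h1 : W ∈ closure (Ico 0 W) := by
      rw [closure_Ico hW0.ne]; exact ⟨hW0.le, le_rfl⟩
    have h2 : Continuous fun s : ℝ => γ (z₀, s) := hγc.comp (by fun_prop)
    exact hK.isClosed.closure_subset (map_mem_closure (f := fun s : ℝ => γ (z₀, s)) h2 h1 hin)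
  have := (hγD _ _).1 (hKD' hlim)
  linarith

end IsDenselyConcaveBump

/-! ### Limits in coordinates and the function -log(-u) -/

theorem EuclideanSpace.tendsto_fin_two {α : Type*} {l : Filter α}
    {f : α → EuclideanSpace ℂ (Fin 2)} {a : EuclideanSpace ℂ (Fin 2)}
    (h0 : Tendsto (fun x => f x 0) l (𝓝 (a 0))) (h1 : Tendsto (fun x => f x 1) l (𝓝 (a 1))) :
    Tendsto f l (𝓝 a) := by
  have h : Tendsto (fun x => WithLp.ofLp (f x)) l (𝓝 (WithLp.ofLp a)) :=
    tendsto_pi_nhds.2 fun i => by fin_cases i; exacts [h0, h1]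
  exact ((PiLp.continuous_toLp 2 (fun _ : Fin 2 => ℂ)).tendsto _).comp h

/-- There is a vector of prescribed norm in the direction of a given one. -/
theorem exists_norm_eq_and_norm_sub_eq (w : ℂ) {s : ℝ} (hs : 0 ≤ s) :
    ∃ w' : ℂ, ‖w'‖ = s ∧ ‖w' - w‖ = |s - ‖w‖| := by
  rcases eq_or_ne w 0 with rfl | hw
  · exact ⟨s, by simp [abs_of_nonneg hs], by simp⟩
  · have hw' : ‖w‖ ≠ 0 := norm_ne_zero_iff.2 hw
    refine ⟨((s / ‖w‖ : ℝ) : ℂ) * w, ?_, ?_⟩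
    · rw [norm_mul, Complex.norm_real, Real.norm_eq_abs, abs_of_nonneg (by positivity)]
      field_simp
    · have : ((s / ‖w‖ : ℝ) : ℂ) * w - w = ((s / ‖w‖ - 1 : ℝ) : ℂ) * w := by push_cast; ring
      rw [this, norm_mul, Complex.norm_real, Real.norm_eq_abs]
      nth_rewrite 2 [← abs_of_nonneg (norm_nonneg w)]
      rw [← abs_mul]
      congr 1
      field_simp

theorem negLogNeg_coe {E : Type*} {u : E → EReal} {p : E} {x : ℝ} (hu : u p = x) (hx : x < 0) :
    negLogNeg u p = ((-Real.log (-x) : ℝ) : EReal) := by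
  have h : (-(x : EReal)).toENNReal = ENNReal.ofReal (-x) := by
    rw [← EReal.coe_neg, EReal.toENNReal_of_ne_top (EReal.coe_ne_top _)]; simp
  rw [negLogNeg, hu, h, ENNReal.log_ofReal, if_neg (by linarith), EReal.coe_neg]

/-- If a negative function `u` is supported from below by real parts of complex affine functions,
then so is `-log(-u)`, which is therefore plurisubharmonic. -/
theorem isPlurisubharmonicOn_negLogNeg_of_support {E : Type*} [NormedAddCommGroup E]
    [NormedSpace ℂ E] {D : Set E} (hD : IsOpen D) {U : E → ℝ} (hU : ContinuousOn U D)
    (hneg : ∀ p ∈ D, U p < 0)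
    (hs : ∀ p ∈ D, ∃ l : E →L[ℂ] ℂ, ∀ᶠ q in 𝓝 p, U p + (l (q - p)).re ≤ U q) :
    IsPlurisubharmonicOn (negLogNeg fun p => (U p : EReal)) D := by
  refine isPlurisubharmonicOn_of_support hD (U := fun p => -Real.log (-U p))
    (fun p hp => negLogNeg_coe rfl (hneg p hp))
    (hU.neg.log fun p hp => (neg_pos.2 (hneg p hp)).ne').neg fun p hp => ?_
  obtain ⟨l, hl⟩ := hs p hp
  have hp0 : 0 < -U p := neg_pos.2 (hneg p hp)
  -- The factor is the slope of the convex increasing function -log(-t) at t = U p; its tangent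
  -- inequality is log s ≤ s - 1.
  refine ⟨((((-U p)⁻¹ : ℝ) : ℂ)) • l, ?_⟩
  filter_upwards [hl, hD.mem_nhds hp] with q hq hqD
  have hq0 : 0 < -U q := neg_pos.2 (hneg q hqD)
  have h1 := Real.log_le_sub_one_of_pos (div_pos hq0 hp0)
  rw [Real.log_div hq0.ne' hp0.ne'] at h1
  have h2 : (((((-U p)⁻¹ : ℝ) : ℂ)) • l) (q - p) = (((-U p)⁻¹ : ℝ) : ℂ) * l (q - p) := rfl
  rw [h2, Complex.re_ofReal_mul]
  have h3 : (-U p)⁻¹ * (l (q - p)).re ≤ (-U p)⁻¹ * (U q - U p) :=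
    mul_le_mul_of_nonneg_left (by linarith) (inv_pos.2 hp0).le
  have h4 : -U q / -U p - 1 = -((-U p)⁻¹ * (U q - U p)) := by
    have hp1 : U p ≠ 0 := by linarith
    field_simp
  linarith

/-! ### Suprema of barrier families -/

/-- A family of functions with values in `[-1, 0)`, locally all but finitely many of them constantly
`-1`, which are supported from below by real parts of complex affine functions. -/
structure IsBarrierFamily {E : Type*} [NormedAddCommGroup E] [NormedSpace ℂ E]
    (D : Set E) (b : ℕ → E → ℝ) : Prop where
  continuousOn : ∀ k, ContinuousOn (b k) D
  neg_one_le : ∀ k, ∀ p ∈ D, -1 ≤ b k p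
  neg : ∀ k, ∀ p ∈ D, b k p < 0
  locallyFinite : ∀ p ∈ D, ∃ N : ℕ, ∀ᶠ q in 𝓝 p, ∀ k, N ≤ k → b k q = -1
  support : ∀ k, ∀ p ∈ D, ∃ l : E →L[ℂ] ℂ, ∀ᶠ q in 𝓝 p, b k p + (l (q - p)).re ≤ b k q

namespace IsBarrierFamily

variable {E : Type*} [NormedAddCommGroup E] [NormedSpace ℂ E] {D : Set E} {b : ℕ → E → ℝ}

theorem bddAbove (hb : IsBarrierFamily D b) {p : E} (hp : p ∈ D) :
    BddAbove (range fun k => b k p) :=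
  ⟨0, by rintro _ ⟨k, rfl⟩; exact (hb.neg k p hp).le⟩

/-- The tail is constantly -1 near p and is absorbed by b 0 ≥ -1; using N + 1 indices keeps b 0
present even if N = 0. -/
theorem exists_eventually_iSup_eq (hb : IsBarrierFamily D b) (hD : IsOpen D) {p : E}
    (hp : p ∈ D) : ∃ N : ℕ, ∀ᶠ q in 𝓝 p,
      ⨆ k, b k q = (Finset.range (N + 1)).sup' Finset.nonempty_range_add_one fun k => b k q := by
  obtain ⟨N, hN⟩ := hb.locallyFinite p hp
  refine ⟨N, ?_⟩
  filter_upwards [hN, hD.mem_nhds hp] with q hq hqD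
  refine le_antisymm (ciSup_le fun k => ?_)
    (Finset.sup'_le _ _ fun k _ => le_ciSup (hb.bddAbove hqD) k)
  rcases lt_or_ge k (N + 1) with hk | hk
  · exact Finset.le_sup' (fun k => b k q) (Finset.mem_range.2 hk)
  · rw [hq k (by omega)]
    exact (hb.neg_one_le 0 q hqD).trans
      (Finset.le_sup' (fun k => b k q) (Finset.mem_range.2 (Nat.succ_pos N)))

theorem exists_iSup_eq (hb : IsBarrierFamily D b) (hD : IsOpen D) {p : E} (hp : p ∈ D) :
    ∃ j, ⨆ k, b k p = b j p := by
  obtain ⟨N, hN⟩ := hb.exists_eventually_iSup_eq hD hp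
  obtain ⟨j, -, hj⟩ := Finset.exists_mem_eq_sup' Finset.nonempty_range_add_one fun k => b k p
  exact ⟨j, hN.self_of_nhds.trans hj⟩

theorem iSup_neg (hb : IsBarrierFamily D b) (hD : IsOpen D) {p : E} (hp : p ∈ D) :
    ⨆ k, b k p < 0 := by
  obtain ⟨j, hj⟩ := hb.exists_iSup_eq hD hp
  rw [hj]; exact hb.neg j p hp

theorem continuousOn_iSup (hb : IsBarrierFamily D b) (hD : IsOpen D) :
    ContinuousOn (fun p => ⨆ k, b k p) D := by
  intro p hp
  obtain ⟨N, hN⟩ := hb.exists_eventually_iSup_eq hD hp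
  refine ContinuousAt.continuousWithinAt (ContinuousAt.congr ?_ (hN.mono fun q hq => hq.symm))
  exact ContinuousAt.finset_sup'_apply _ fun k _ => (hb.continuousOn k).continuousAt (hD.mem_nhds hp)

/-- A support of a member attaining the supremum at p also supports the supremum. -/
theorem support_iSup (hb : IsBarrierFamily D b) (hD : IsOpen D) {p : E} (hp : p ∈ D) :
    ∃ l : E →L[ℂ] ℂ, ∀ᶠ q in 𝓝 p, (⨆ k, b k p) + (l (q - p)).re ≤ ⨆ k, b k q := by
  obtain ⟨j, hj⟩ := hb.exists_iSup_eq hD hp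
  obtain ⟨l, hl⟩ := hb.support j p hp
  refine ⟨l, ?_⟩
  filter_upwards [hl, hD.mem_nhds hp] with q hq hqD
  rw [hj]
  exact hq.trans (le_ciSup (hb.bddAbove hqD) j)

end IsBarrierFamily

/-! ### Approaching the boundary over a dense base -/

/-- A property of the points over a dense set of base points that are close to the boundary within
their fibre holds frequently near each boundary point. -/
theorem frequently_nhdsWithin_of_dense_base {A : ℝ → ℝ} (hA : Continuous A) {Z : Set ℂ} (hZ : Dense Z)
    {a : EuclideanSpace ℂ (Fin 2)} (ha : a ∈ frontier (hartogsDomain A))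
    (ha0 : hartogsDefining A a = 0) {P : EuclideanSpace ℂ (Fin 2) → Prop}
    (hP : ∀ z ∈ Z, ∃ τ : ℝ, 0 < τ ∧ ∀ p : EuclideanSpace ℂ (Fin 2), p 0 = z →
      -τ < hartogsDefining A p → hartogsDefining A p < 0 → P p) :
    ∃ᶠ p in 𝓝[hartogsDomain A] a, P p := by
  have hr : Continuous (hartogsDefining A) := by unfold hartogsDefining; fun_prop
  have hDo : IsOpen (hartogsDomain A) := isOpen_lt hr continuous_const
  set g : ℂ → ℝ := fun z => A z.re + A z.im with hg
  have hgc : Continuous g := by fun_prop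
  have hrg : ∀ p, hartogsDefining A p = ‖p 1‖ ^ 2 - g (p 0) := fun p => by
    simp only [hartogsDefining, hg]; ring
  have hcl : a ∈ closure (hartogsDomain A) := frontier_subset_closure ha
  rw [hrg] at ha0
  -- it suffices to find points of the domain over `Z` with nearby coordinates
  suffices H : ∀ η : ℝ, 0 < η → ∃ p ∈ hartogsDomain A, P p ∧ ‖p 0 - a 0‖ < η ∧ ‖p 1 - a 1‖ < η by
    choose! f hfD hfP hf0 hf1 using fun n : ℕ => H (1 / ((n : ℝ) + 1)) Nat.one_div_pos_of_nat
    have hlim : ∀ i : Fin 2, (∀ n, ‖f n i - a i‖ < 1 / ((n : ℝ) + 1)) →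
        Tendsto (fun n => f n i) atTop (𝓝 (a i)) := fun i hi =>
      tendsto_iff_norm_sub_tendsto_zero.2 (squeeze_zero (fun _ => norm_nonneg _)
        (fun n => (hi n).le) tendsto_one_div_add_atTop_nhds_zero_nat)
    have hf : Tendsto f atTop (𝓝[hartogsDomain A] a) :=
      tendsto_nhdsWithin_iff.2 ⟨EuclideanSpace.tendsto_fin_two (hlim 0 hf0) (hlim 1 hf1),
        Eventually.of_forall hfD⟩
    exact hf.frequently (Eventually.of_forall hfP).frequently
  intro η hη
  have hsa : √(g (a 0)) = ‖a 1‖ := by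
    rw [show g (a 0) = ‖a 1‖ ^ 2 by linarith, Real.sqrt_sq (norm_nonneg _)]
  have hNo : ∀ᶠ p in 𝓝 a, ‖p 0 - a 0‖ < η ∧ |√(g (p 0)) - ‖a 1‖| < η / 2 := by
    have c1 : Continuous fun p : EuclideanSpace ℂ (Fin 2) => ‖p 0 - a 0‖ := by fun_prop
    have c2 : Continuous fun p : EuclideanSpace ℂ (Fin 2) => |√(g (p 0)) - ‖a 1‖| := by fun_prop
    refine ((c1.tendsto a).eventually_lt_const (by simpa using hη)).and
      ((c2.tendsto a).eventually_lt_const (by simpa [hsa] using hη))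
  -- Start at a point of the domain near a, move z into Z with w fixed, then replace w by a vector
  -- in the direction of a 1 with norm just below √(g z), itself close to ‖a 1‖.
  obtain ⟨p, hpD, hp⟩ := ((mem_closure_iff_frequently.1 hcl).and_eventually
    hNo.eventually_nhds).exists
  have hline : Continuous fun z : ℂ => (!₂[z, p 1] : EuclideanSpace ℂ (Fin 2)) := by
    refine (PiLp.continuous_toLp 2 _).comp (continuous_pi fun i => ?_)
    fin_cases i
    · exact continuous_id
    · exact continuous_const
  have hpp : (!₂[p 0, p 1] : EuclideanSpace ℂ (Fin 2)) = p := by ext i; fin_cases i <;> rfl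
  have hev : ∀ᶠ z in 𝓝 (p 0), (!₂[z, p 1] : EuclideanSpace ℂ (Fin 2)) ∈ hartogsDomain A ∧
      ‖z - a 0‖ < η ∧ |√(g z) - ‖a 1‖| < η / 2 := by
    have := (hline.tendsto (p 0))
    rw [hpp] at this
    exact this.eventually (Filter.Eventually.and (hDo.mem_nhds hpD) hp)
  obtain ⟨z, hzZ, hzD, hz0, hz1⟩ := ((mem_closure_iff_frequently.1 (hZ (p 0))).and_eventually
    hev).exists
  have hgz : 0 < g z := by
    have : hartogsDefining A (!₂[z, p 1] : EuclideanSpace ℂ (Fin 2)) < 0 := hzD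
    rw [hrg] at this
    have h1 : (!₂[z, p 1] : EuclideanSpace ℂ (Fin 2)) 0 = z := rfl
    rw [h1] at this
    nlinarith [sq_nonneg ‖(!₂[z, p 1] : EuclideanSpace ℂ (Fin 2)) 1‖]
  obtain ⟨τ, hτ, hPτ⟩ := hP z hzZ
  have hG : 0 < √(g z) := Real.sqrt_pos.2 hgz
  have hGs : √(g z) ^ 2 = g z := Real.sq_sqrt hgz.le
  obtain ⟨s, hsG, hs0, hsη, hsτ⟩ : ∃ s, s < √(g z) ∧ 0 < s ∧ √(g z) - η / 2 < s ∧
      g z - τ < s ^ 2 := by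
    have c1 : Tendsto (fun s : ℝ => s ^ 2) (𝓝[<] √(g z)) (𝓝 (√(g z) ^ 2)) :=
      ((continuous_pow 2).tendsto _).mono_left nhdsWithin_le_nhds
    have c0 : Tendsto (fun s : ℝ => s) (𝓝[<] √(g z)) (𝓝 (√(g z))) := nhdsWithin_le_nhds
    exact ((eventually_mem_nhdsWithin (a := √(g z)) (s := Iio √(g z))).and
      ((c0.eventually_const_lt hG).and ((c0.eventually_const_lt (by linarith)).and
        (c1.eventually_const_lt (by linarith))))).exists
  obtain ⟨w, hw, hwa⟩ := exists_norm_eq_and_norm_sub_eq (a 1) hs0.le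
  have hrw : hartogsDefining A (!₂[z, w] : EuclideanSpace ℂ (Fin 2)) = s ^ 2 - g z := by
    rw [hrg, ← hw]; rfl
  have hneg : s ^ 2 - g z < 0 := by nlinarith
  refine ⟨!₂[z, w], ?_, hPτ _ rfl (by rw [hrw]; linarith) (by rw [hrw]; exact hneg), hz0, ?_⟩
  · show hartogsDefining A _ < 0
    rw [hrw]; exact hneg
  · show ‖w - a 1‖ < η
    rw [hwa, abs_lt]
    rw [abs_lt] at hz1
    constructor <;> linarith

theorem denseRange_rat_complex : DenseRange fun q : ℚ × ℚ => (⟨q.1, q.2⟩ : ℂ) := by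
  have h := (Rat.denseRange_cast (𝕜 := ℝ)).prodMap (Rat.denseRange_cast (𝕜 := ℝ))
  exact Complex.equivRealProdCLM.symm.surjective.denseRange.comp h
    Complex.equivRealProdCLM.symm.continuous

/-! ### Construction of the barriers -/

namespace IsDenselyConcaveBump

variable {A A' : ℝ → ℝ}

theorem exists_ball_eq (h : IsDenselyConcaveBump A A') (q₁ q₂ : ℚ) :
    ∃ R : ℝ, 0 < R ∧ ∀ z : ℂ, ‖z - ⟨q₁, q₂⟩‖ < R → A z.re + A z.im =
      A q₁ + A q₂ + A' q₁ * (z.re - q₁) + A' q₂ * (z.im - q₂) - ‖z - ⟨q₁, q₂⟩‖ ^ 2 / 2 := by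
  have c1 := (Complex.continuous_re.tendsto (⟨q₁, q₂⟩ : ℂ)).eventually (h.eq_near_rat q₁)
  have c2 := (Complex.continuous_im.tendsto (⟨q₁, q₂⟩ : ℂ)).eventually (h.eq_near_rat q₂)
  obtain ⟨R, hR, hball⟩ := Metric.eventually_nhds_iff.1 (c1.and c2)
  refine ⟨R, hR, fun z hz => ?_⟩
  obtain ⟨h1, h2⟩ := hball (y := z) (by rwa [dist_eq_norm])
  rw [h1, h2, ← Complex.normSq_eq_norm_sq, Complex.normSq_apply]
  simp only [Complex.sub_re, Complex.sub_im]
  ring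

/-- Barriers at the boundary points over a dense set of base points. -/
theorem exists_isBarrierFamily (h : IsDenselyConcaveBump A A') :
    ∃ (b : ℕ → EuclideanSpace ℂ (Fin 2) → ℝ) (Z : Set ℂ), IsBarrierFamily (hartogsDomain A) b ∧
      Dense Z ∧ ∀ z ∈ Z, ∀ c : ℝ, c < 0 → ∃ τ : ℝ, 0 < τ ∧ ∀ p : EuclideanSpace ℂ (Fin 2),
        p 0 = z → -τ < hartogsDefining A p → hartogsDefining A p < 0 → ∃ k, c < b k p := by
  obtain ⟨e, he⟩ := exists_surjective_nat (ℚ × ℚ)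
  set a : ℕ → ℂ := fun k => ⟨(e k).1, (e k).2⟩ with ha
  have hdense : DenseRange a := by
    change Dense (range ((fun q : ℚ × ℚ => (⟨q.1, q.2⟩ : ℂ)) ∘ e))
    rw [he.range_comp]
    exact denseRange_rat_complex
  choose R hR hRz using fun k => h.exists_ball_eq (e k).1 (e k).2
  change ∀ k, ∀ z : ℂ, ‖z - a k‖ < R k → _ at hRz
  set T : ℕ → ℂ → ℝ := fun k z => A (e k).1 + A (e k).2 + A' (e k).1 * (z.re - (e k).1) +
    A' (e k).2 * (z.im - (e k).2) with hT
  set r := hartogsDefining A with hr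
  have hrc : Continuous r := h.continuous_hartogsDefining
  have hDo := h.isOpen_hartogsDomain
  set H : ℕ → EuclideanSpace ℂ (Fin 2) → ℝ := fun k p => ‖p 1‖ ^ 2 - T k (p 0) with hH
  have hHc : ∀ k, Continuous (H k) := fun k => by
    have : Continuous (T k) := by fun_prop
    fun_prop
  have hHr : ∀ k p, ‖p 0 - a k‖ < R k → H k p = r p - ‖p 0 - a k‖ ^ 2 / 2 := fun k p hp => by
    have := hRz k (p 0) hp
    simp only [hH, hr, hartogsDefining, hT]
    have h1 : ‖p 0 - ({ re := ((e k).1 : ℝ), im := ((e k).2 : ℝ) } : ℂ)‖ = ‖p 0 - a k‖ := rfl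
    linarith
  -- The first bound makes the barrier equal -1 on the outer half of its disc, so it glues to the
  -- constant; the second forces local finiteness.
  set δ : ℕ → ℝ := fun k => min (R k ^ 2 / 8) (1 / ((k : ℝ) + 1)) with hδ
  have hδ0 : ∀ k, 0 < δ k := fun k => lt_min (by have := hR k; positivity) Nat.one_div_pos_of_nat
  set b : ℕ → EuclideanSpace ℂ (Fin 2) → ℝ := fun k p =>
    if ‖p 0 - a k‖ < R k then max (H k p / δ k) (-1) else -1 with hb
  have hb_in : ∀ k p, ‖p 0 - a k‖ < R k → b k p = max (H k p / δ k) (-1) := fun k p hp => if_pos hp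
  have hb_out : ∀ k p, ¬ ‖p 0 - a k‖ < R k → b k p = -1 := fun k p hp => if_neg hp
  have hb_ge : ∀ k p, -1 ≤ b k p := fun k p => by
    by_cases hp : ‖p 0 - a k‖ < R k
    · rw [hb_in k p hp]; exact le_max_right _ _
    · rw [hb_out k p hp]
  have hb_eq : ∀ k p, (‖p 0 - a k‖ < R k → H k p ≤ -δ k) → b k p = -1 := fun k p hp => by
    by_cases hin : ‖p 0 - a k‖ < R k
    · rw [hb_in k p hin, max_eq_right]
      rw [div_le_iff₀ (hδ0 k)]
      linarith [hp hin]
    · exact hb_out k p hin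
  have hin_ev : ∀ k (p : EuclideanSpace ℂ (Fin 2)), ‖p 0 - a k‖ < R k →
      ∀ᶠ q in 𝓝 p, ‖q 0 - a k‖ < R k := fun k p hp => by
    have c : Continuous fun q : EuclideanSpace ℂ (Fin 2) => ‖q 0 - a k‖ := by fun_prop
    exact (c.tendsto p).eventually_lt_const hp
  refine ⟨b, range a, ⟨fun k p hp => ?_, fun k p _ => hb_ge k p, fun k p hp => ?_, fun p hp => ?_,
    fun k p hp => ?_⟩, hdense, ?_⟩
  · refine ContinuousAt.continuousWithinAt ?_
    by_cases hin : ‖p 0 - a k‖ < R k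
    · refine ContinuousAt.congr (f := fun q => max (H k q / δ k) (-1)) ?_
        ((hin_ev k p hin).mono fun q hq => (hb_in k q hq).symm)
      exact (((hHc k).div_const _).max continuous_const).continuousAt
    · refine ContinuousAt.congr (f := fun _ => (-1 : ℝ)) continuousAt_const ?_
      have c : Continuous fun q : EuclideanSpace ℂ (Fin 2) => ‖q 0 - a k‖ := by fun_prop
      have hlt : R k / 2 < ‖p 0 - a k‖ := by have := hR k; linarith
      filter_upwards [(c.tendsto p).eventually_const_lt hlt, hDo.mem_nhds hp] with q hq hqD
      refine (hb_eq k q fun hqin => ?_).symm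
      have h1 : r q < 0 := hqD
      have h2 : δ k ≤ R k ^ 2 / 8 := min_le_left _ _
      rw [hHr k q hqin]
      nlinarith [hR k]
  · by_cases hin : ‖p 0 - a k‖ < R k
    · rw [hb_in k p hin]
      have h1 : r p < 0 := hp
      refine max_lt (div_neg_of_neg_of_pos ?_ (hδ0 k)) (by norm_num)
      rw [hHr k p hin]
      nlinarith [sq_nonneg ‖p 0 - a k‖]
    · rw [hb_out k p hin]; norm_num
  · have h1 : r p < 0 := hp
    obtain ⟨N, hN⟩ := exists_nat_one_div_lt (show 0 < -r p / 2 by linarith)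
    refine ⟨N, ?_⟩
    filter_upwards [(hrc.tendsto p).eventually_lt_const (show r p < r p / 2 by linarith)]
      with q hq k hk
    refine hb_eq k q fun hqin => ?_
    have h2 : δ k ≤ 1 / ((k : ℝ) + 1) := min_le_right _ _
    have h3 : 1 / ((k : ℝ) + 1) ≤ 1 / ((N : ℝ) + 1) := Nat.one_div_le_one_div hk
    rw [hHr k q hqin]
    nlinarith [sq_nonneg ‖q 0 - a k‖]
  · by_cases hone : b k p = -1
    -- The minimal value -1 is supported by a constant.
    · exact ⟨0, Eventually.of_forall fun q => by simpa [hone] using hb_ge k q⟩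
    have hin : ‖p 0 - a k‖ < R k := by
      by_contra hin; exact hone (hb_out k p hin)
    have hbp : b k p = H k p / δ k := by
      rw [hb_in k p hin] at hone ⊢
      rcases max_choice (H k p / δ k) (-1) with hm | hm
      · exact hm
      · exact absurd hm hone
    -- Re(βz) is the linear part of T k, so the support is exact in z; in w it loses only |q 1 - p
    -- 1|², by convexity of |w|².
    set β : ℂ := ⟨A' (e k).1, -A' (e k).2⟩ with hβ
    refine ⟨(((δ k)⁻¹ : ℝ) : ℂ) • ((2 * starRingEnd ℂ (p 1)) •
      (EuclideanSpace.proj 1 : EuclideanSpace ℂ (Fin 2) →L[ℂ] ℂ) -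
        β • (EuclideanSpace.proj 0 : EuclideanSpace ℂ (Fin 2) →L[ℂ] ℂ)), ?_⟩
    filter_upwards [hin_ev k p hin] with q hq
    rw [hbp, hb_in k q hq]
    refine le_trans ?_ (le_max_left _ _)
    have e1 : (((((δ k)⁻¹ : ℝ) : ℂ) • ((2 * starRingEnd ℂ (p 1)) •
      (EuclideanSpace.proj 1 : EuclideanSpace ℂ (Fin 2) →L[ℂ] ℂ) -
        β • (EuclideanSpace.proj 0 : EuclideanSpace ℂ (Fin 2) →L[ℂ] ℂ))) (q - p)) =
        (((δ k)⁻¹ : ℝ) : ℂ) * ((2 * starRingEnd ℂ (p 1)) * (q 1 - p 1) - β * (q 0 - p 0)) := rfl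
    rw [e1, Complex.re_ofReal_mul, div_eq_inv_mul, div_eq_inv_mul, ← mul_add]
    refine mul_le_mul_of_nonneg_left ?_ (inv_pos.2 (hδ0 k)).le
    simp only [hH, hT, ← Complex.normSq_eq_norm_sq, Complex.normSq_apply, hβ]
    simp
    nlinarith [sq_nonneg ((q 1).re - (p 1).re), sq_nonneg ((q 1).im - (p 1).im)]
  · rintro _ ⟨k, rfl⟩ c hc
    refine ⟨-c * δ k, mul_pos (neg_pos.2 hc) (hδ0 k), fun p hp hτ _ => ⟨k, ?_⟩⟩
    have hp0 : ‖p 0 - a k‖ = 0 := by rw [hp, sub_self, norm_zero]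
    have hin : ‖p 0 - a k‖ < R k := by rw [hp0]; exact hR k
    rw [hb_in k p hin]
    refine lt_max_of_lt_left ?_
    rw [lt_div_iff₀ (hδ0 k), hHr k p hin, hp0]
    change -(-c * δ k) < r p at hτ
    linarith

end IsDenselyConcaveBump

/-! ### Boundary limsups and conclusion -/

theorem limsup_eq_zero_of_frequently {X : Type*} {l : Filter X} {D : Set X} (hD : D ∈ l)
    {U : X → ℝ} (hneg : ∀ p ∈ D, U p < 0) (hf : ∀ c < 0, ∃ᶠ p in l, c < U p) :
    limsup (fun p => (U p : EReal)) l = 0 := by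
  refine le_antisymm (limsup_le_of_le (h := ?_)) (le_of_forall_lt fun c hc => ?_)
  · filter_upwards [hD] with p hp
    exact_mod_cast (hneg p hp).le
  · obtain ⟨x, hcx, hx⟩ := EReal.lt_iff_exists_real_btwn.1 hc
    refine hcx.trans_le (le_limsup_of_frequently_le
      ((hf x (by exact_mod_cast hx)).mono fun p hp => ?_))
    exact EReal.coe_le_coe_iff.2 hp.le

theorem limsup_negLogNeg_eq_top_of_frequently {X : Type*} {l : Filter X} {D : Set X} (hD : D ∈ l)
    {U : X → ℝ} (hneg : ∀ p ∈ D, U p < 0) (hf : ∀ c < 0, ∃ᶠ p in l, c < U p) :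
    limsup (negLogNeg fun p => (U p : EReal)) l = ⊤ := by
  refine EReal.eq_top_iff_forall_lt _ |>.2 fun c => ?_
  refine (EReal.coe_lt_coe_iff.2 (lt_add_one c)).trans_le (le_limsup_of_frequently_le
    (((hf (-Real.exp (-(c + 1))) (neg_lt_zero.2 (Real.exp_pos _))).and_eventually hD).mono
      fun p hp => ?_))
  rw [negLogNeg_coe (u := fun p => (U p : EReal)) rfl (hneg p hp.2), EReal.coe_le_coe_iff]
  have h1 : Real.log (-U p) ≤ -(c + 1) := by
    rw [← Real.log_exp (-(c + 1))]
    exact Real.log_le_log (neg_pos.2 (hneg p hp.2)) (by linarith [hp.1])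
  linarith

theorem theorem1 (ε : ℝ) (hε : ε ∈ Set.Ioo (0 : ℝ) 1) :
    ∃ D : Set (EuclideanSpace ℂ (Fin 2)),
      IsOpen D ∧ IsConnected D ∧ Bornology.IsBounded D ∧
      HasC1HolderBoundary D (Real.toNNReal (1 - ε)) ∧
      ¬ IsPseudoconvex D ∧
      ∃ u : EuclideanSpace ℂ (Fin 2) → EReal,
        IsPlurisubharmonicOn u D ∧ (∀ z ∈ D, u z < 0) ∧
        (∀ a ∈ frontier D, Filter.limsup u (𝓝[D] a) = 0) ∧
        IsPlurisubharmonicOn (negLogNeg u) D ∧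
        (∀ a ∈ frontier D, Filter.limsup (negLogNeg u) (𝓝[D] a) = ⊤) := by
  obtain ⟨A, A', h⟩ := exists_isDenselyConcaveBump
  obtain ⟨b, Z, hb, hZ, hbZ⟩ := h.exists_isBarrierFamily
  have hDo := h.isOpen_hartogsDomain
  set U : EuclideanSpace ℂ (Fin 2) → ℝ := fun p => ⨆ k, b k p with hU
  have hneg : ∀ p ∈ hartogsDomain A, U p < 0 := fun p hp => hb.iSup_neg hDo hp
  have hfreq : ∀ a ∈ frontier (hartogsDomain A), ∀ c < 0, ∃ᶠ p in 𝓝[hartogsDomain A] a, c < U p := by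
    intro a ha c hc
    refine frequently_nhdsWithin_of_dense_base h.continuous hZ ha (h.hartogsDefining_eq_zero ha)
      fun z hz => ?_
    obtain ⟨τ, hτ, hp⟩ := hbZ z hz c hc
    refine ⟨τ, hτ, fun p h0 h1 h2 => ?_⟩
    obtain ⟨k, hk⟩ := hp p h0 h1 h2
    exact hk.trans_le (le_ciSup (hb.bddAbove h2) k)
  refine ⟨hartogsDomain A, hDo, h.isConnected_hartogsDomain, h.isBounded_hartogsDomain,
    h.hasC1HolderBoundary ?_, h.not_isPseudoconvex_hartogsDomain, fun p => (U p : EReal),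
    isPlurisubharmonicOn_of_support hDo (fun _ _ => rfl) (hb.continuousOn_iSup hDo)
      (fun p hp => hb.support_iSup hDo hp),
    fun p hp => EReal.coe_lt_coe_iff.2 (hneg p hp),
    fun a ha => limsup_eq_zero_of_frequently self_mem_nhdsWithin hneg (hfreq a ha),
    isPlurisubharmonicOn_negLogNeg_of_support hDo (hb.continuousOn_iSup hDo) hneg
      (fun p hp => hb.support_iSup hDo hp),
    fun a ha => limsup_negLogNeg_eq_top_of_frequently self_mem_nhdsWithin hneg (hfreq a ha)⟩
  rw [Real.toNNReal_le_one]
  linarith [hε.1]
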